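/- A residuated lattice is an algebra $(A,\wedge,\vee,\cdot,\backslash,/,1)$ such that $(A,\wedge,\vee)$ is a lattice, $(A,\cdot,1)$ is a monoid, and $y\le x\backslash z \iff xy\le z \iff x\le z/y$ for all $x,y,z\in A$. It is conic if every element is comparable with $1$, semiconic if it belongs to the variety generated by the conic residuated lattices, idempotent if it satisfies $x^2=x$, and commutative if it satisfies $xy=yx$. Put $x^r=x\backslash 1$, $x^\ell=1/x$, $x^\star=x^\ell\wedge x^r$ and $\gamma(x)=x^{\ell r}\wedge x^{r\ell}$. A semiconic idempotent residuated lattice is rigid if it satisfies $x^r=x^{r\star\star}$ and $x^\ell=x^{\ell\star\star}$. An algebra is finitely subdirectly irreducible (FSI) if its identity congruence is not the intersection of two non-identity congruences. A V-formation in a class $\mathcal K$ consists of $\mathbf A,\mathbf B,\mathbf C\in\mathcal K$ and embeddings $f_B\colon\mathbf A\to\mathbf B$, $f_C\colon\mathbf A\to\mathbf C$. A 1-amalgam of it in $\mathcal K$ consists of $\mathbf D\in\mathcal K$, a homomorphism $g_B\colon\mathbf B\to\mathbf D$ and an embedding $g_C\colon\mathbf C\to\mathbf D$ with $g_Bf_B=g_Cf_C$;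 it is an amalgam if $g_B$ is also an embedding. The class $\mathcal K$ has the amalgamation property if every V-formation in $\mathcal K$ has an amalgam in $\mathcal K$. **Theorem.** The amalgamation property fails for the variety $\mathcal V$ of rigid semiconic idempotent residuated lattices, and it fails for the subvariety of commutative members of $\mathcal V$. A witness is the following V-formation. Let $\mathbf A$, $\mathbf B$, $\mathbf C$ be the ordinal sums, listed in ascending order, of singletons and antichains (the sets in braces) $$A:\ a^*<1<a,$$ $$B:\ a^*<b^*<1<\{b_1',b_2',b_3'\}<b<\{b_1,b_2,b_3\}<a,$$ $$C:\ a^*<c^*<d^*<1<\{d_1,d_2\}<d<c<\{c_1,c_2\}<a.$$ The elements $1$ and $s,s^*$ for $s=a$ in $A$, $s=a,b$ in $B$, $s=a,c,d$ in $C$ form the skeleton; each is the top of a block, where the elements of an antichain belong to the block of the next element above them, and all other blocks are singletons. Let $\delta(x)=0$ for $x=1$ and, for the remaining elements, let $\delta(x)$ be $k$ if $x$ lies in the block of $s$ or of $s^*$, where $s$ is the $k$-th skeleton element above $1$. The product is $xy=x$ if $\delta(x)>\delta(y)$, $xy=y$ if $\delta(x)<\delta(y)$; and if $\delta(x)=\delta(y)$,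 then $xy=x\vee y$ if $x,y>1$, and $xy=x\wedge y$ otherwise. The residuals are determined by the order and the product. Then: 1. $\mathbf A,\mathbf B,\mathbf C$ are commutative rigid idempotent residuated lattices that are conic (hence semiconic) and FSI, and the inclusions $\mathbf A\to\mathbf B$ and $\mathbf A\to\mathbf C$ are embeddings. 2. In $\mathbf B$ the intervals $[b,a]$ and $[1,b]$ are isomorphic to the five-element lattice $\mathbf M_3$, and $\gamma^{-1}(a)=[b,a]\setminus\{b\}$, $\gamma^{-1}(b)=[1,b]\setminus\{1\}$. 3. This V-formation has no 1-amalgam in $\mathcal V$; in particular it has none among the FSI members of $\mathcal V$. -/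

import Mathlib

universe u v

/-- Residuated lattices `(A, ⊓, ⊔, *, \, /, 1)`: `ld x z` is `x \ z` and `rd z y` is `z / y`. -/
class ResiduatedLattice (A : Type u) extends Lattice A, Monoid A where
  ld : A → A → A
  rd : A → A → A
  le_ld_iff : ∀ x y z : A, y ≤ ld x z ↔ x * y ≤ z
  le_rd_iff : ∀ x y z : A, x ≤ rd z y ↔ x * y ≤ z

namespace ResiduatedLattice

/-- Homomorphisms preserve all the operations of residuated lattices. -/
structure Hom (A : Type u) (B : Type v) [ResiduatedLattice A] [ResiduatedLattice B] where
  toFun : A → B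
  map_inf : ∀ x y, toFun (x ⊓ y) = toFun x ⊓ toFun y
  map_sup : ∀ x y, toFun (x ⊔ y) = toFun x ⊔ toFun y
  map_mul : ∀ x y, toFun (x * y) = toFun x * toFun y
  map_ld : ∀ x y, toFun (ld x y) = ld (toFun x) (toFun y)
  map_rd : ∀ x y, toFun (rd x y) = rd (toFun x) (toFun y)
  map_one : toFun 1 = 1

/-- An embedding is an injective homomorphism. -/
def Hom.IsEmbedding {A : Type u} {B : Type v} [ResiduatedLattice A] [ResiduatedLattice B]
    (f : Hom A B) : Prop :=
  Function.Injective f.toFun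

/-- Terms in the language of residuated lattices over countably many variables. -/
inductive RLTerm : Type
  | var (n : ℕ)
  | one
  | inf (s t : RLTerm)
  | sup (s t : RLTerm)
  | mul (s t : RLTerm)
  | ld (s t : RLTerm)
  | rd (s t : RLTerm)

/-- The value of a term under an assignment of the variables. -/
def RLTerm.eval {A : Type u} [ResiduatedLattice A] (e : ℕ → A) : RLTerm → A
  | .var n => e n
  | .one => 1
  | .inf s t => s.eval e ⊓ t.eval e
  | .sup s t => s.eval e ⊔ t.eval e
  | .mul s t => s.eval e * t.eval e
  | .ld s t => ResiduatedLattice.ld (s.eval e) (t.eval e)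
  | .rd s t => ResiduatedLattice.rd (s.eval e) (t.eval e)

/-- The algebra `A` satisfies the identity `s ≈ t`. -/
def Satisfies (A : Type u) [ResiduatedLattice A] (s t : RLTerm) : Prop :=
  ∀ e : ℕ → A, s.eval e = t.eval e

/-- Every element is comparable with `1`. -/
def IsConic (A : Type u) [ResiduatedLattice A] : Prop :=
  ∀ x : A, x ≤ 1 ∨ 1 ≤ x

/-- Membership in the variety generated by the conic residuated lattices: all the identities
that hold in every conic residuated lattice hold in `A`. -/
def IsSemiconic (A : Type u) [ResiduatedLattice A] : Prop :=
  ∀ s t : RLTerm,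
    (∀ (C : Type u) [ResiduatedLattice C], IsConic C → Satisfies C s t) → Satisfies A s t

def IsIdempotent (A : Type u) [ResiduatedLattice A] : Prop :=
  ∀ x : A, x * x = x

def IsCommutative (A : Type u) [ResiduatedLattice A] : Prop :=
  ∀ x y : A, x * y = y * x

section Inverses

variable {A : Type u} [ResiduatedLattice A]

/-- The right inverse `x^r = x \ 1`. -/
def rinv (x : A) : A := ld x 1

/-- The left inverse `x^ℓ = 1 / x`. -/
def linv (x : A) : A := rd 1 x

/-- The operation `x^⋆ = x^ℓ ⊓ x^r`. -/
def star (x : A) : A := linv x ⊓ rinv x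

/-- The operation `γ(x) = x^{ℓr} ⊓ x^{rℓ}`. -/
def gamma (x : A) : A := rinv (linv x) ⊓ linv (rinv x)

end Inverses

/-- The identities `x^r = x^{r⋆⋆}` and `x^ℓ = x^{ℓ⋆⋆}`. -/
def IsRigid (A : Type u) [ResiduatedLattice A] : Prop :=
  ∀ x : A, rinv x = star (star (rinv x)) ∧ linv x = star (star (linv x))

/-- The variety of rigid semiconic idempotent residuated lattices. -/
def RigidSemiconicIdempotent (A : Type u) [ResiduatedLattice A] : Prop :=
  IsSemiconic A ∧ IsIdempotent A ∧ IsRigid A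

/-- The variety of commutative rigid semiconic idempotent residuated lattices. -/
def CommRigidSemiconicIdempotent (A : Type u) [ResiduatedLattice A] : Prop :=
  RigidSemiconicIdempotent A ∧ IsCommutative A

/-- The equivalence relation `θ` is a congruence of the residuated lattice `A`. -/
structure IsCongruence {A : Type u} [ResiduatedLattice A] (θ : Setoid A) : Prop where
  inf : ∀ x x' y y' : A, θ x x' → θ y y' → θ (x ⊓ y) (x' ⊓ y')
  sup : ∀ x x' y y' : A, θ x x' → θ y y' → θ (x ⊔ y) (x' ⊔ y')
  mul : ∀ x x' y y' : A, θ x x' → θ y y' → θ (x * y) (x' * y')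
  ld : ∀ x x' y y' : A, θ x x' → θ y y' → θ (ld x y) (ld x' y')
  rd : ∀ x x' y y' : A, θ x x' → θ y y' → θ (rd x y) (rd x' y')

/-- Finite subdirect irreducibility: the identity relation is not the intersection of two
nonidentity congruences. -/
def IsFSI (A : Type u) [ResiduatedLattice A] : Prop :=
  ∀ θ ψ : Setoid A, IsCongruence θ → IsCongruence ψ → θ ⊓ ψ = ⊥ → θ = ⊥ ∨ ψ = ⊥

/-- The V-formation `B ← A → C` has an amalgam in the class `K`. -/
def HasAmalgam (K : ∀ (D : Type u) [ResiduatedLattice D], Prop)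
    {A B C : Type u} [ResiduatedLattice A] [ResiduatedLattice B] [ResiduatedLattice C]
    (fB : Hom A B) (fC : Hom A C) : Prop :=
  ∃ (D : Type u) (_ : ResiduatedLattice D) (gB : Hom B D) (gC : Hom C D),
    K D ∧ gB.IsEmbedding ∧ gC.IsEmbedding ∧ ∀ x : A, gB.toFun (fB.toFun x) = gC.toFun (fC.toFun x)

/-- The V-formation `B ← A → C` has a 1-amalgam in the class `K`: only the homomorphism from `C`
is required to be an embedding. -/
def HasOneAmalgam (K : ∀ (D : Type u) [ResiduatedLattice D], Prop)
    {A B C : Type u} [ResiduatedLattice A] [ResiduatedLattice B] [ResiduatedLattice C]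
    (fB : Hom A B) (fC : Hom A C) : Prop :=
  ∃ (D : Type u) (_ : ResiduatedLattice D) (gB : Hom B D) (gC : Hom C D),
    K D ∧ gC.IsEmbedding ∧ ∀ x : A, gB.toFun (fB.toFun x) = gC.toFun (fC.toFun x)

/-- The amalgamation property of the class `K`: every V-formation in `K` has an amalgam in `K`. -/
def AmalgamationProperty (K : ∀ (D : Type u) [ResiduatedLattice D], Prop) : Prop :=
  ∀ (A B C : Type u) [ResiduatedLattice A] [ResiduatedLattice B] [ResiduatedLattice C]
    (fB : Hom A B) (fC : Hom A C),
    K A → K B → K C → fB.IsEmbedding → fC.IsEmbedding → HasAmalgam K fB fC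

/-! ### Finite commutative conic algebras from a skeleton and blocks

The algebras below are ordinal sums of antichains, described by a height function `ht`.
The elements of even height are the elements of the skeleton, an odd Sugihara chain
in which `s ↦ s*` changes the sign of the height; `pt h` is the element of even height `h`.
The elements of odd height `h` lie in the block with top element `pt (h + 1)`. -/

section Layered

variable {A : Type u} (ht : A → ℤ) (pt : ℤ → A)

/-- The order of an ordinal sum of antichains. -/
def layerLE (x y : A) : Prop := x = y ∨ ht x < ht y

instance [DecidableEq A] (x y : A) : Decidable (layerLE ht x y) :=
  inferInstanceAs (Decidable (x = y ∨ ht x < ht y))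

/-- The order as a structure. -/
@[reducible]
def layerPartialOrder : PartialOrder A where
  le := layerLE ht
  le_refl x := Or.inl rfl
  le_trans x y z := by
    rintro (rfl | h) (rfl | h')
    · exact Or.inl rfl
    · exact Or.inr h'
    · exact Or.inr h
    · exact Or.inr (h.trans h')
  le_antisymm x y := by
    rintro (h | h) (h' | h')
    · exact h
    · exact h
    · exact h'.symm
    · exact absurd (h.trans h') (lt_irrefl _)

/-- The height of the top element of the block of `x`. -/
def blockHt (x : A) : ℤ := if ht x % 2 = 0 then ht x else ht x + 1

variable [DecidableEq A]

/-- Two incomparable elements of height `h` have the meet `pt (h - 1)`. -/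
def layerInf (x y : A) : A :=
  if layerLE ht x y then x else if layerLE ht y x then y else pt (ht x - 1)

/-- Two incomparable elements of height `h` have the join `pt (h + 1)`. -/
def layerSup (x y : A) : A :=
  if layerLE ht x y then y else if layerLE ht y x then x else pt (ht x + 1)

/-- The product `x * y`, for `x` and `y` in the blocks of `s` and `t`, is the element whose block
is further away from `1`; when the distances are equal, `x * y` is the join if `1 < s = t`, and
the meet otherwise. -/
def layerMul (x y : A) : A :=
  if |blockHt ht y| < |blockHt ht x| then x
  else if |blockHt ht x| < |blockHt ht y| then y
  else if 0 < blockHt ht x ∧ 0 < blockHt ht y then layerSup ht pt x y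
  else layerInf ht pt x y

/-- The residual `x → y`, for `x` in the block of `s`, is `s* ⊔ y` if `x ≤ y`, and `s* ⊓ y`
otherwise. -/
def layerImp (x y : A) : A :=
  if layerLE ht x y then layerSup ht pt (pt (-blockHt ht x)) y
  else layerInf ht pt (pt (-blockHt ht x)) y

/-- The residuated lattice with the operations above, provided that the laws hold. -/
@[reducible]
def layerRL (one : A)
    (h_sup : ∀ x y : A, layerLE ht x (layerSup ht pt x y) ∧ layerLE ht y (layerSup ht pt x y))
    (h_sup_le : ∀ x y z : A, layerLE ht x z → layerLE ht y z → layerLE ht (layerSup ht pt x y) z)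
    (h_inf : ∀ x y : A, layerLE ht (layerInf ht pt x y) x ∧ layerLE ht (layerInf ht pt x y) y)
    (h_le_inf : ∀ x y z : A, layerLE ht x y → layerLE ht x z → layerLE ht x (layerInf ht pt y z))
    (h_assoc : ∀ x y z : A, layerMul ht pt (layerMul ht pt x y) z =
      layerMul ht pt x (layerMul ht pt y z))
    (h_comm : ∀ x y : A, layerMul ht pt x y = layerMul ht pt y x)
    (h_one : ∀ x : A, layerMul ht pt one x = x)
    (h_imp : ∀ x y z : A, layerLE ht y (layerImp ht pt x z) ↔ layerLE ht (layerMul ht pt x y) z) :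
    ResiduatedLattice A where
  toPartialOrder := layerPartialOrder ht
  inf := layerInf ht pt
  sup := layerSup ht pt
  le_sup_left x y := (h_sup x y).1
  le_sup_right x y := (h_sup x y).2
  sup_le x y z := h_sup_le x y z
  inf_le_left x y := (h_inf x y).1
  inf_le_right x y := (h_inf x y).2
  le_inf x y z := h_le_inf x y z
  mul := layerMul ht pt
  one := one
  mul_assoc := h_assoc
  one_mul := h_one
  mul_one x := (h_comm x one).trans (h_one x)
  ld x z := layerImp ht pt x z
  rd z y := layerImp ht pt y z
  le_ld_iff := h_imp
  le_rd_iff x y z := by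
    have h : layerMul ht pt x y = layerMul ht pt y x := h_comm x y
    have h' := h_imp y x z
    rw [← h] at h'
    exact h'

end Layered

/-- The three-element algebra `A`, the chain `a* < 1 < a`. -/
inductive AlgA : Type u
  | a' | e | a
  deriving DecidableEq

/-- The eleven-element algebra `B`, in ascending order:
`a* < b* < 1 < b₁', b₂', b₃' < b < b₁, b₂, b₃ < a`. -/
inductive AlgB : Type u
  | a' | b' | e | p1 | p2 | p3 | b | b1 | b2 | b3 | a
  deriving DecidableEq

/-- The eleven-element algebra `C`, in ascending order:
`a* < c* < d* < 1 < d₁, d₂ < d < c < c₁, c₂ < a`. -/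
inductive AlgC : Type u
  | a' | c' | d' | e | d1 | d2 | d | c | c1 | c2 | a
  deriving DecidableEq

instance : Fintype AlgA.{u} where
  elems := {.a', .e, .a}
  complete x := by cases x <;> simp

instance : Fintype AlgB.{u} where
  elems := {.a', .b', .e, .p1, .p2, .p3, .b, .b1, .b2, .b3, .a}
  complete x := by cases x <;> simp

instance : Fintype AlgC.{u} where
  elems := {.a', .c', .d', .e, .d1, .d2, .d, .c, .c1, .c2, .a}
  complete x := by cases x <;> simp

def AlgA.ht : AlgA.{u} → ℤ
  | .a' => -2 | .e => 0 | .a => 2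

def AlgA.pt (h : ℤ) : AlgA.{u} :=
  if h = -2 then .a' else if h = 2 then .a else .e

def AlgB.ht : AlgB.{u} → ℤ
  | .a' => -4 | .b' => -2 | .e => 0
  | .p1 => 1 | .p2 => 1 | .p3 => 1 | .b => 2
  | .b1 => 3 | .b2 => 3 | .b3 => 3 | .a => 4

def AlgB.pt (h : ℤ) : AlgB.{u} :=
  if h = -4 then .a' else if h = -2 then .b' else if h = 2 then .b else if h = 4 then .a else .e

def AlgC.ht : AlgC.{u} → ℤ
  | .a' => -6 | .c' => -4 | .d' => -2 | .e => 0
  | .d1 => 1 | .d2 => 1 | .d => 2 | .c => 4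
  | .c1 => 5 | .c2 => 5 | .a => 6

def AlgC.pt (h : ℤ) : AlgC.{u} :=
  if h = -6 then .a' else if h = -4 then .c' else if h = -2 then .d'
  else if h = 2 then .d else if h = 4 then .c else if h = 6 then .a else .e

instance : ResiduatedLattice AlgA.{u} :=
  layerRL AlgA.ht AlgA.pt .e (by decide +kernel) (by decide +kernel) (by decide +kernel)
    (by decide +kernel) (by decide +kernel) (by decide +kernel) (by decide +kernel)
    (by decide +kernel)

instance : ResiduatedLattice AlgB.{u} :=
  layerRL AlgB.ht AlgB.pt .e (by decide +kernel) (by decide +kernel) (by decide +kernel)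
    (by decide +kernel) (by decide +kernel) (by decide +kernel) (by decide +kernel)
    (by decide +kernel)

instance : ResiduatedLattice AlgC.{u} :=
  layerRL AlgC.ht AlgC.pt .e (by decide +kernel) (by decide +kernel) (by decide +kernel)
    (by decide +kernel) (by decide +kernel) (by decide +kernel) (by decide +kernel)
    (by decide +kernel)

/-- The inclusion of `A` in `B`. -/
def inclAB : Hom AlgA.{u} AlgB.{u} where
  toFun
    | .a' => .a' | .e => .e | .a => .a
  map_inf := by decide +kernel
  map_sup := by decide +kernel
  map_mul := by decide +kernel
  map_ld := by decide +kernel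
  map_rd := by decide +kernel
  map_one := rfl

/-- The inclusion of `A` in `C`. -/
def inclAC : Hom AlgA.{u} AlgC.{u} where
  toFun
    | .a' => .a' | .e => .e | .a => .a
  map_inf := by decide +kernel
  map_sup := by decide +kernel
  map_mul := by decide +kernel
  map_ld := by decide +kernel
  map_rd := by decide +kernel
  map_one := rfl

/-- The five-element lattice `M₃`: a bottom element, three pairwise incomparable elements and a
top element. -/
inductive M3 : Type
  | bot | x1 | x2 | x3 | top
  deriving DecidableEq

def M3.ht : M3 → ℤ
  | .bot => 0 | .x1 => 1 | .x2 => 1 | .x3 => 1 | .top => 2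

instance : PartialOrder M3 := layerPartialOrder M3.ht

end ResiduatedLattice

/-!
Let `gB : B → D` and `gC : C → D` form a 1-amalgam with `D` semiconic and idempotent. Since `gC` is
injective, `1 ≰ gC(d*)`. A *normal filter* of `D` (an upward closed submonoid closed under
conjugation and under meets with `1`) gives a preorder `x ≼ y :⟺ x \ y ∈ N` for which the
operations of `D` keep the laws of a residuated lattice. It plays the role of a quotient, which is
never formed. Choose `N` maximal with respect to omitting `gC(d*)`. In a semiconic algebra every
iterated conjugate of `(x \ 1) ⊓ 1` has the join `1` with every iterated conjugate of `x ⊓ 1`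
(`IsSemiconic.one_le_iterConj_sup`), and maximality of `N` then forces `x ≼ 1` or `1 ≼ x` for every
`x` (`IsNormalFilter.ld_one_mem_or_mem`). This is the statement that finitely subdirectly
irreducible semiconic algebras are conic.

In a conic idempotent algebra, a skeleton element `u > 1` is comparable with each positive element
(`IsNormalFilter.le_or_le_of_rinv`). Consequently, if the block of `y` lies above `u`, then `u ≼ y`.
Applied to `b` and the elements `c₁, c₂` of the block of `a`, this gives `b ≼ c₁ ⊓ c₂ = c`; applied
to `c` and `b₁, b₂`, it gives `c ≼ b₁ ⊓ b₂ = b`. Thus `b` and `c` coincide in the quotient, so `d`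
lies below the block of `b` and `d ≼ b₁' ⊓ b₂' = 1`. But then `gC(d*) ∈ N`, a contradiction
(`not_hasOneAmalgam`). Hence the amalgamation property fails in every class of semiconic idempotent
algebras that contains `A`, `B` and `C`, in particular in both varieties.

The remaining assertions concern finite algebras. Those about identities and about order are
decidable; the algebras are finitely subdirectly irreducible because there is a largest element
strictly below `1` (`isFSI_of_coatom`), which every nonidentity congruence identifies with `1`.
-/

namespace ResiduatedLattice

section Basic

variable {A : Type u} [ResiduatedLattice A]

instance : MulLeftMono A :=
  ⟨fun z _ y h => (le_ld_iff z _ (z * y)).1 (h.trans ((le_ld_iff z y _).2 le_rfl))⟩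

instance : MulRightMono A :=
  ⟨fun z _ y h => (le_rd_iff _ z (y * z)).1 (h.trans ((le_rd_iff y z _).2 le_rfl))⟩

theorem mul_ld_le (x y : A) : x * ld x y ≤ y := (le_ld_iff _ _ _).1 le_rfl

theorem rd_mul_le (x y : A) : rd y x * x ≤ y := (le_rd_iff _ _ _).1 le_rfl

theorem one_le_ld_iff {x y : A} : 1 ≤ ld x y ↔ x ≤ y := by
  rw [le_ld_iff, mul_one]

/-- For negative elements, joining with a fixed element is submultiplicative. -/
theorem sup_mul_sup_le {x y s : A} (hx : x ≤ 1) (hy : y ≤ 1) (hs : s ≤ 1) :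
    (x ⊔ s) * (y ⊔ s) ≤ x * y ⊔ s := by
  rw [← le_rd_iff]
  refine sup_le ?_ ?_ <;> rw [le_rd_iff, ← le_ld_iff] <;> refine sup_le ?_ ?_ <;> rw [le_ld_iff]
  · exact le_sup_left
  · exact (mul_le_of_le_one_left' hx).trans le_sup_right
  · exact (mul_le_of_le_one_right' hy).trans le_sup_right
  · exact (mul_le_of_le_one_right' hs).trans le_sup_right

end Basic

/-! ### Iterated conjugates -/

section Conjugates

variable {A : Type u} [ResiduatedLattice A]

/-- The left conjugate of `x` by `a`, truncated at `1`. -/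
def leftConj (a x : A) : A := ld a (x * a) ⊓ 1

/-- The right conjugate of `x` by `a`, truncated at `1`. -/
def rightConj (a x : A) : A := rd (a * x) a ⊓ 1

theorem leftConj_mono (a : A) {x y : A} (h : x ≤ y) : leftConj a x ≤ leftConj a y := by
  exact inf_le_inf_right _ ((le_ld_iff _ _ _).2 ((mul_ld_le _ _).trans (mul_le_mul_left h a)))

theorem rightConj_mono (a : A) {x y : A} (h : x ≤ y) : rightConj a x ≤ rightConj a y := by
  exact inf_le_inf_right _ ((le_rd_iff _ _ _).2 ((rd_mul_le _ _).trans (mul_le_mul_right h a)))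

theorem one_le_leftConj (a : A) {x : A} (h : 1 ≤ x) : 1 ≤ leftConj a x :=
  le_inf (one_le_ld_iff.2 (le_mul_of_one_le_left' h)) le_rfl

theorem one_le_rightConj (a : A) {x : A} (h : 1 ≤ x) : 1 ≤ rightConj a x :=
  le_inf ((le_rd_iff _ _ _).2 (by simpa using le_mul_of_one_le_right' h)) le_rfl

theorem leftConj_mul_le (a x y : A) : leftConj a x * leftConj a y ≤ leftConj a (x * y) := by
  refine le_inf ((le_ld_iff _ _ _).2 ?_) (mul_le_one' inf_le_right inf_le_right)
  calc a * (leftConj a x * leftConj a y) ≤ a * (ld a (x * a) * ld a (y * a)) := by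
        gcongr <;> exact inf_le_left
    _ = a * ld a (x * a) * ld a (y * a) := (mul_assoc _ _ _).symm
    _ ≤ x * a * ld a (y * a) := mul_le_mul_left (mul_ld_le _ _) _
    _ = x * (a * ld a (y * a)) := mul_assoc _ _ _
    _ ≤ x * (y * a) := mul_le_mul_right (mul_ld_le _ _) _
    _ = x * y * a := (mul_assoc _ _ _).symm

theorem rightConj_mul_le (a x y : A) : rightConj a x * rightConj a y ≤ rightConj a (x * y) := by
  refine le_inf ((le_rd_iff _ _ _).2 ?_) (mul_le_one' inf_le_right inf_le_right)
  calc rightConj a x * rightConj a y * a ≤ rd (a * x) a * rd (a * y) a * a := by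
        gcongr <;> exact inf_le_left
    _ = rd (a * x) a * (rd (a * y) a * a) := mul_assoc _ _ _
    _ ≤ rd (a * x) a * (a * y) := mul_le_mul_right (rd_mul_le _ _) _
    _ = rd (a * x) a * a * y := (mul_assoc _ _ _).symm
    _ ≤ a * x * y := mul_le_mul_left (rd_mul_le _ _) _
    _ = a * (x * y) := mul_assoc _ _ _

/-- The iterated conjugate of `x` by the entries of a list, the head of the list being applied
first: `Sum.inl a` stands for the left and `Sum.inr a` for the right conjugation by `a`. -/
def iterConj : List (A ⊕ A) → A → A
  | [], x => x
  | .inl a :: L, x => iterConj L (leftConj a x)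
  | .inr a :: L, x => iterConj L (rightConj a x)

theorem iterConj_le_one (L : List (A ⊕ A)) {x : A} (hx : x ≤ 1) : iterConj L x ≤ 1 := by
  induction L generalizing x with
  | nil => exact hx
  | cons a L ih => cases a <;> exact ih inf_le_right

theorem iterConj_mono (L : List (A ⊕ A)) {x y : A} (h : x ≤ y) : iterConj L x ≤ iterConj L y := by
  induction L generalizing x y with
  | nil => exact h
  | cons a L ih =>
    cases a
    · exact ih (leftConj_mono _ h)
    · exact ih (rightConj_mono _ h)

theorem iterConj_mul_le (L : List (A ⊕ A)) (x y : A) :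
    iterConj L x * iterConj L y ≤ iterConj L (x * y) := by
  induction L generalizing x y with
  | nil => exact le_rfl
  | cons a L ih =>
    cases a
    · exact (ih _ _).trans (iterConj_mono _ (leftConj_mul_le _ _ _))
    · exact (ih _ _).trans (iterConj_mono _ (rightConj_mul_le _ _ _))

/-- The term for an iterated conjugate of `t`. Only the sides on which the conjugations act are
taken from the list; the conjugating elements are the variables with indices `k, k + 1, …`. -/
def iterConjTerm : List (A ⊕ A) → ℕ → RLTerm → RLTerm
  | [], _, t => t
  | .inl _ :: L, k, t => iterConjTerm L (k + 1) (.inf (.ld (.var k) (.mul t (.var k))) .one)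
  | .inr _ :: L, k, t => iterConjTerm L (k + 1) (.inf (.rd (.mul (.var k) t) (.var k)) .one)

theorem eval_iterConjTerm (e : ℕ → A) (L : List (A ⊕ A)) (k : ℕ) (t : RLTerm)
    (h : ∀ i (hi : i < L.length), e (k + i) = L[i].elim id id) :
    (iterConjTerm L k t).eval e = iterConj L (t.eval e) := by
  induction L generalizing k t with
  | nil => rfl
  | cons a L ih =>
    have h0 := h 0 (by simp)
    have hs : ∀ i (hi : i < L.length), e (k + 1 + i) = L[i].elim id id := fun i hi => by
      rw [add_assoc, add_comm 1 i]
      exact h (i + 1) (by simpa using hi)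
    cases a with
    | inl a =>
      replace h0 : e k = a := h0
      rw [iterConjTerm, ih _ _ hs, iterConj, leftConj]
      simp only [RLTerm.eval, h0]
    | inr a =>
      replace h0 : e k = a := h0
      rw [iterConjTerm, ih _ _ hs, iterConj, rightConj]
      simp only [RLTerm.eval, h0]

omit [ResiduatedLattice A] in
theorem one_le_eval_iterConjTerm {C : Type v} [ResiduatedLattice C] (e : ℕ → C)
    (L : List (A ⊕ A)) (k : ℕ) (t : RLTerm) (h : 1 ≤ t.eval e) :
    1 ≤ (iterConjTerm L k t).eval e := by
  induction L generalizing k t with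
  | nil => exact h
  | cons a L ih =>
    cases a
    · exact ih _ _ (one_le_leftConj _ h)
    · exact ih _ _ (one_le_rightConj _ h)

/-- The identities of conic residuated lattices which express that, in the congruence lattice, the
congruences generated by `(x \ 1) ⊓ 1 ~ 1` and by `x ⊓ 1 ~ 1` intersect trivially. -/
theorem IsSemiconic.one_le_iterConj_sup (hA : IsSemiconic A) (x : A) (L M : List (A ⊕ A)) :
    1 ≤ iterConj L (ld x 1 ⊓ 1) ⊔ iterConj M (x ⊓ 1) := by
  -- variable `0` is `x`, followed by the entries of `L` and those of `M`
  let e : ℕ → A := fun n => n.casesOn x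
    (fun n => ((L ++ M).map (Sum.elim id id)).getD n 1)
  have key := hA
    (.inf .one (.sup (iterConjTerm L 1 (.inf (.ld (.var 0) .one) .one))
      (iterConjTerm M (1 + L.length) (.inf (.var 0) .one)))) .one ?_ e
  · have hL : (iterConjTerm L 1 (.inf (.ld (.var 0) .one) .one)).eval e = iterConj L (ld x 1 ⊓ 1) := by
      refine eval_iterConjTerm e L 1 _ fun i hi => ?_
      rw [add_comm]
      simp [e, List.getElem?_append_left, hi]
    have hM : (iterConjTerm M (1 + L.length) (.inf (.var 0) .one)).eval e = iterConj M (x ⊓ 1) := by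
      refine eval_iterConjTerm e M _ _ fun i hi => ?_
      rw [add_assoc, add_comm]
      simp [e, hi]
    simp only [RLTerm.eval, hL, hM] at key
    exact inf_eq_left.1 key
  · intro C _ hC f
    refine inf_eq_left.2 ?_
    rcases hC (f 0) with h | h
    · exact (one_le_eval_iterConjTerm f L 1 (.inf (.ld (.var 0) .one) .one)
        (le_inf (one_le_ld_iff.2 h) le_rfl)).trans le_sup_left
    · exact (one_le_eval_iterConjTerm f M _ (.inf (.var 0) .one) (le_inf h le_rfl)).trans le_sup_right

end Conjugates

/-! ### Normal filters -/

section NormalFilter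

variable {A : Type u} [ResiduatedLattice A]

/-- Normal filters, the sets `{x | x ⊓ 1 ~ 1}` for the congruences `~`. In the quotient by the
congruence of `N`, the relation `x ≤ y` amounts to `ld x y ∈ N`, and `1 ≤ x` to `x ∈ N`. -/
structure IsNormalFilter (N : Set A) : Prop where
  one_mem : 1 ∈ N
  mem_of_le : ∀ {x y : A}, x ∈ N → x ≤ y → y ∈ N
  mul_mem : ∀ {x y : A}, x ∈ N → y ∈ N → x * y ∈ N
  inf_one_mem : ∀ {x : A}, x ∈ N → x ⊓ 1 ∈ N
  leftConj_mem : ∀ (a : A) {x : A}, x ∈ N → leftConj a x ∈ N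
  rightConj_mem : ∀ (a : A) {x : A}, x ∈ N → rightConj a x ∈ N

theorem isNormalFilter_Ici_one : IsNormalFilter (Set.Ici (1 : A)) where
  one_mem := le_rfl
  mem_of_le hx h := le_trans hx h
  mul_mem hx hy := one_le_mul hx hy
  inf_one_mem hx := le_inf hx le_rfl
  leftConj_mem a _ hx := one_le_leftConj a hx
  rightConj_mem a _ hx := one_le_rightConj a hx

theorem isNormalFilter_sUnion {S : Set (Set A)} (hS : ∀ N ∈ S, IsNormalFilter N)
    (hc : IsChain (· ⊆ ·) S) (hne : S.Nonempty) : IsNormalFilter (⋃₀ S) where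
  one_mem := let ⟨N, hN⟩ := hne; ⟨N, hN, (hS N hN).one_mem⟩
  mem_of_le := fun ⟨N, hN, hx⟩ h => ⟨N, hN, (hS N hN).mem_of_le hx h⟩
  mul_mem := by
    rintro x y ⟨N, hN, hx⟩ ⟨M, hM, hy⟩
    rcases hc.total hN hM with h | h
    · exact ⟨M, hM, (hS M hM).mul_mem (h hx) hy⟩
    · exact ⟨N, hN, (hS N hN).mul_mem hx (h hy)⟩
  inf_one_mem := fun ⟨N, hN, hx⟩ => ⟨N, hN, (hS N hN).inf_one_mem hx⟩
  leftConj_mem := fun a _ ⟨N, hN, hx⟩ => ⟨N, hN, (hS N hN).leftConj_mem a hx⟩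
  rightConj_mem := fun a _ ⟨N, hN, hx⟩ => ⟨N, hN, (hS N hN).rightConj_mem a hx⟩

theorem exists_maximal_isNormalFilter_notMem {t : A} (ht : ¬ 1 ≤ t) :
    ∃ N : Set A, Maximal (fun N => IsNormalFilter N ∧ t ∉ N) N := by
  refine (zorn_subset_nonempty {N : Set A | IsNormalFilter N ∧ t ∉ N} (fun S hS hc hne => ?_)
    (Set.Ici 1) ⟨isNormalFilter_Ici_one, ht⟩).imp fun N h => h.2
  exact ⟨⋃₀ S, ⟨isNormalFilter_sUnion (fun N hN => (hS hN).1) hc hne,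
    fun ⟨N, hN, h⟩ => (hS hN).2 h⟩, fun N hN => Set.subset_sUnion_of_mem hN⟩

namespace IsNormalFilter

variable {N : Set A}

theorem iterConj_mem (hN : IsNormalFilter N) (L : List (A ⊕ A)) {x : A} (hx : x ∈ N) :
    iterConj L x ∈ N := by
  induction L generalizing x with
  | nil => exact hx
  | cons a L ih =>
    cases a
    · exact ih (hN.leftConj_mem _ hx)
    · exact ih (hN.rightConj_mem _ hx)

/-- The elements all of whose iterated conjugates, truncated at `1`, have a join with `s` in `N`
form a normal filter. -/
theorem orthogonal (hN : IsNormalFilter N) {s : A} (hs : s ≤ 1) :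
    IsNormalFilter {x : A | ∀ L, iterConj L (x ⊓ 1) ⊔ s ∈ N} where
  one_mem L := hN.mem_of_le (hN.iterConj_mem L (hN.inf_one_mem hN.one_mem)) le_sup_left
  mem_of_le hx h L := hN.mem_of_le (hx L)
    (sup_le_sup_right (iterConj_mono L (inf_le_inf_right _ h)) s)
  mul_mem hx hy L := hN.mem_of_le (hN.mul_mem (hx L) (hy L))
    ((sup_mul_sup_le (iterConj_le_one _ inf_le_right) (iterConj_le_one _ inf_le_right) hs).trans
      (sup_le_sup_right ((iterConj_mul_le L _ _).trans (iterConj_mono L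
        (le_inf (mul_le_mul' inf_le_left inf_le_left) (mul_le_one' inf_le_right inf_le_right)))) s))
  inf_one_mem hx L := by simpa only [inf_assoc, inf_idem] using hx L
  leftConj_mem a _ hx L := hN.mem_of_le (hx (.inl a :: L)) (sup_le_sup_right
    (iterConj_mono L (le_inf (leftConj_mono a inf_le_left) inf_le_right)) s)
  rightConj_mem a _ hx L := hN.mem_of_le (hx (.inr a :: L)) (sup_le_sup_right
    (iterConj_mono L (le_inf (rightConj_mono a inf_le_left) inf_le_right)) s)

/-- The quotient of a semiconic algebra by a normal filter that is maximal with respect to omitting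
some `t ≤ 1` is conic. -/
theorem ld_one_mem_or_mem (hA : IsSemiconic A) {t : A} (ht : t ≤ 1)
    (hN : Maximal (fun N => IsNormalFilter N ∧ t ∉ N) N) (x : A) : ld x 1 ∈ N ∨ x ∈ N := by
  have hF := hN.prop.1
  -- if the filter orthogonal to `s` contains an element outside `N`, then it contains `t`
  have key : ∀ s ≤ 1, ∀ p ∉ N, (∀ L, iterConj L (p ⊓ 1) ⊔ s ∈ N) → t ⊔ s ∈ N := by
    intro s hs p hp h
    by_contra hts
    refine hp (hN.le_of_ge ⟨hF.orthogonal hs, fun h' => hts ?_⟩ (fun y hy L => ?_) h)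
    · simpa only [iterConj, inf_eq_left.2 ht] using h' []
    · exact hF.mem_of_le (hF.iterConj_mem L (hF.inf_one_mem hy)) le_sup_left
  by_contra! hx
  refine hN.prop.2 (sup_idem t ▸ key t ht x hx.2 fun M => ?_)
  rw [sup_comm]
  exact key _ (iterConj_le_one M inf_le_right) _ hx.1
    fun L => hF.mem_of_le hF.one_mem (hA.one_le_iterConj_sup x L M)

/-! ### The preorder of a normal filter -/

theorem ld_mem_of_le (hN : IsNormalFilter N) {x y : A} (h : x ≤ y) : ld x y ∈ N :=
  hN.mem_of_le hN.one_mem (one_le_ld_iff.2 h)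

theorem ld_mem_of_mul_le (hN : IsNormalFilter N) {n x y : A} (hn : n ∈ N) (h : n * x ≤ y) :
    ld x y ∈ N :=
  hN.mem_of_le (hN.leftConj_mem x hn)
    ((le_ld_iff _ _ _).2 ((mul_le_mul_right inf_le_left x).trans ((mul_ld_le _ _).trans h)))

theorem rd_mem_of_ld_mem (hN : IsNormalFilter N) {x y : A} (h : ld x y ∈ N) : rd y x ∈ N :=
  hN.mem_of_le (hN.rightConj_mem x h)
    ((le_rd_iff _ _ _).2 ((mul_le_mul_left inf_le_left x).trans
      ((rd_mul_le _ _).trans (mul_ld_le _ _))))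

theorem ld_mem_trans (hN : IsNormalFilter N) {x y z : A} (hxy : ld x y ∈ N) (hyz : ld y z ∈ N) :
    ld x z ∈ N := by
  refine hN.mem_of_le (hN.mul_mem hxy hyz) ((le_ld_iff _ _ _).2 ?_)
  rw [← mul_assoc]
  exact (mul_le_mul_left (mul_ld_le _ _) _).trans (mul_ld_le _ _)

theorem ld_inf_mem (hN : IsNormalFilter N) {x y z : A} (hy : ld x y ∈ N) (hz : ld x z ∈ N) :
    ld x (y ⊓ z) ∈ N := by
  refine hN.mem_of_le (hN.mul_mem (hN.inf_one_mem hy) (hN.inf_one_mem hz))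
    ((le_ld_iff _ _ _).2 (le_inf ?_ ?_)) <;> rw [← le_ld_iff]
  · exact (mul_le_of_le_one_right' inf_le_right).trans inf_le_left
  · exact (mul_le_of_le_one_left' inf_le_right).trans inf_le_left

theorem ld_mul_mul_mem_left (hN : IsNormalFilter N) {x y : A} (h : ld x y ∈ N) (z : A) :
    ld (z * x) (z * y) ∈ N := by
  refine hN.mem_of_le h ((le_ld_iff _ _ _).2 ?_)
  rw [mul_assoc]
  exact mul_le_mul_right (mul_ld_le _ _) z

theorem ld_mul_mul_mem_right (hN : IsNormalFilter N) {x y : A} (h : ld x y ∈ N) (z : A) :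
    ld (x * z) (y * z) ∈ N := by
  refine hN.ld_mem_of_mul_le (hN.rd_mem_of_ld_mem h) ?_
  rw [← mul_assoc]
  exact mul_le_mul_left (rd_mul_le _ _) z

theorem ld_rinv_mem (hN : IsNormalFilter N) {x y : A} (h : ld x y ∈ N) :
    ld (rinv y) (rinv x) ∈ N := by
  have h1 : ld (x * rinv y) 1 ∈ N :=
    hN.ld_mem_trans (hN.ld_mul_mul_mem_right h _) (hN.ld_mem_of_le (mul_ld_le y 1))
  refine hN.mem_of_le h1 ((le_ld_iff _ _ _).2 ((le_ld_iff _ _ _).2 ?_))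
  rw [← mul_assoc]
  exact mul_ld_le _ _

/-- If the quotient by `N` is conic, the right inverse `u` of an element `z ≤ 1` is comparable there
with every `y ≥ 1`, provided that `u * z = z`. -/
theorem le_or_le_of_rinv (hN : IsNormalFilter N) (hc : ∀ x, ld x 1 ∈ N ∨ x ∈ N)
    (hi : IsIdempotent A) {z y : A} (hz : z ≤ 1) (hy : 1 ≤ y) (hu : rinv z * z = z) :
    ld y (rinv z) ∈ N ∨ ld (rinv z) y ∈ N := by
  refine (hc (z * y)).imp (fun h => ?_) fun h => ?_
  · refine hN.mem_of_le h ((le_ld_iff _ _ _).2 ((le_ld_iff _ _ _).2 ?_))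
    rw [← mul_assoc]
    exact mul_ld_le _ _
  · -- `1 ≼ z * y` gives `y ≼ z * y`, hence `u ≼ u * y ≼ u * z * y = z * y ≤ y`
    have h1 : ld y (z * y) ∈ N := by
      refine hN.ld_mem_of_mul_le h ?_
      rw [mul_assoc, hi y]
    have h2 := hN.ld_mul_mul_mem_left h1 (rinv z)
    rw [← mul_assoc, hu] at h2
    exact hN.ld_mem_trans (hN.ld_mem_of_le (le_mul_of_one_le_right' hy))
      (hN.ld_mem_trans h2 (hN.ld_mem_of_le (mul_le_of_le_one_left' hz)))

/-- If the quotient by `N` is conic, the skeleton element `u = z^r` lies below every `y ≥ 1` of a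
block above it: here `u * z = z = u^r`, and `z` is not below `y^r` modulo `N`. -/
theorem ld_rinv_mem_of_notMem (hN : IsNormalFilter N) (hc : ∀ x, ld x 1 ∈ N ∨ x ∈ N)
    (hi : IsIdempotent A) {z y : A} (hz : z ≤ 1) (hy : 1 ≤ y) (hu : rinv z * z = z)
    (hzz : rinv (rinv z) = z) (hzy : ld z (rinv y) ∉ N) : ld (rinv z) y ∈ N := by
  refine (hN.le_or_le_of_rinv hc hi hz hy hu).resolve_left fun h => hzy ?_
  simpa only [hzz] using hN.ld_rinv_mem h

end IsNormalFilter

end NormalFilter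

/-! ### The V-formation -/

section Homomorphisms

variable {A : Type u} {B : Type v} [ResiduatedLattice A] [ResiduatedLattice B] (f : Hom A B)

theorem Hom.map_rinv (x : A) : f.toFun (rinv x) = rinv (f.toFun x) := by
  rw [rinv, f.map_ld, f.map_one, rinv]

theorem Hom.mono {x y : A} (h : x ≤ y) : f.toFun x ≤ f.toFun y := by
  rw [← inf_eq_left, ← f.map_inf, inf_eq_left.2 h]

end Homomorphisms

instance : DecidableLE AlgA.{u} := fun x y => inferInstanceAs (Decidable (layerLE AlgA.ht x y))

instance : DecidableLE AlgB.{u} := fun x y => inferInstanceAs (Decidable (layerLE AlgB.ht x y))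

instance : DecidableLE AlgC.{u} := fun x y => inferInstanceAs (Decidable (layerLE AlgC.ht x y))

/-- A `1`-amalgam identifies `b` with `c` modulo a normal filter that omits `d*`, which forces
`d ≼ 1` because the elements `b₁'` and `b₂'` of the block of `b` have the meet `1`. -/
theorem not_hasOneAmalgam (K : ∀ (D : Type u) [ResiduatedLattice D], Prop)
    (hK : ∀ (D : Type u) [ResiduatedLattice D], K D → IsSemiconic D ∧ IsIdempotent D) :
    ¬ HasOneAmalgam.{u} K inclAB.{u} inclAC.{u} := by
  rintro ⟨D, _, f, g, hKD, hg, hfg⟩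
  obtain ⟨hsc, hi⟩ := hK D hKD
  have ha : f.toFun .a' = g.toFun .a' := hfg .a'
  have hd1 : g.toFun .d' ≤ 1 := g.map_one ▸ g.mono (by decide +kernel)
  have hd : ¬ 1 ≤ g.toFun .d' := fun h => by
    have : g.toFun .d' = g.toFun .e := (le_antisymm hd1 h).trans g.map_one.symm
    cases hg this
  obtain ⟨N, hmax⟩ := exists_maximal_isNormalFilter_notMem hd
  obtain ⟨hN, hdN⟩ := hmax.prop
  have hc := IsNormalFilter.ld_one_mem_or_mem hsc hd1 hmax
  -- the instances in `B` and `C` of the comparison of a skeleton element with a positive one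
  have compB : ∀ (z : AlgB) (y : D), z ≤ 1 → 1 ≤ y → rinv z * z = z → rinv (rinv z) = z →
      ld (f.toFun z) (rinv y) ∉ N → ld (f.toFun (rinv z)) y ∈ N := by
    intro z y hz hy hu hzz h
    rw [f.map_rinv]
    exact hN.ld_rinv_mem_of_notMem hc hi (f.map_one ▸ f.mono hz) hy
      (by rw [← f.map_rinv, ← f.map_mul, hu]) (by rw [← f.map_rinv, ← f.map_rinv, hzz]) h
  have compC : ∀ (z : AlgC) (y : D), z ≤ 1 → 1 ≤ y → rinv z * z = z → rinv (rinv z) = z →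
      ld (g.toFun z) (rinv y) ∉ N → ld (g.toFun (rinv z)) y ∈ N := by
    intro z y hz hy hu hzz h
    rw [g.map_rinv]
    exact hN.ld_rinv_mem_of_notMem hc hi (g.map_one ▸ g.mono hz) hy
      (by rw [← g.map_rinv, ← g.map_mul, hu]) (by rw [← g.map_rinv, ← g.map_rinv, hzz]) h
  have haN : g.toFun .a' ∉ N := fun h =>
    hdN (hN.mem_of_le h (g.mono (by decide +kernel)))
  have hB : ∀ y : AlgB, 1 ≤ y → 1 ≤ f.toFun y := fun y hy => f.map_one ▸ f.mono hy
  have hC : ∀ y : AlgC, 1 ≤ y → 1 ≤ g.toFun y := fun y hy => g.map_one ▸ g.mono hy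
  -- `b ≼ c₁ ⊓ c₂ = c`
  have hbc1 : ∀ y : AlgC, 1 ≤ y → rinv y = .a' → ld (f.toFun .b) (g.toFun y) ∈ N := by
    intro y hy hya
    refine compB .b' _ (by decide +kernel) (hC y hy) (by decide +kernel) (by decide +kernel) ?_
    rw [← g.map_rinv, hya, ← ha, ← f.map_ld]
    exact fun h => haN (ha ▸ h)
  have hbc : ld (f.toFun .b) (g.toFun .c) ∈ N := by
    have := hN.ld_inf_mem (hbc1 .c1 (by decide +kernel) (by decide +kernel))
      (hbc1 .c2 (by decide +kernel) (by decide +kernel))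
    rwa [← g.map_inf] at this
  -- `c ≼ b₁ ⊓ b₂ = b`
  have hcb : ld (g.toFun .c) (f.toFun .b) ∈ N := by
    have hcb1 : ∀ y : AlgB, 1 ≤ y → rinv y = .a' → ld (g.toFun .c) (f.toFun y) ∈ N := by
      intro y hy hya
      refine compC .c' _ (by decide +kernel) (hB y hy) (by decide +kernel) (by decide +kernel) ?_
      rw [← f.map_rinv, hya, ha, ← g.map_ld]
      exact haN
    have := hN.ld_inf_mem (hcb1 .b1 (by decide +kernel) (by decide +kernel))
      (hcb1 .b2 (by decide +kernel) (by decide +kernel))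
    rwa [← f.map_inf] at this
  -- `d` lies below the block of `b`, because `d* ≼ b*` fails
  have hdp : ∀ y : AlgB, 1 ≤ y → rinv y = .b' → ld (g.toFun .d) (f.toFun y) ∈ N := by
    intro y hy hyb
    refine compC .d' _ (by decide +kernel) (hB y hy) (by decide +kernel) (by decide +kernel) ?_
    intro h
    rw [← f.map_rinv, hyb] at h
    -- `d* ≼ b* ≼ c*` contradicts `d* \ c* = c* ≤ d*`
    have hbc' : ld (f.toFun .b') (g.toFun .c') ∈ N := by
      have := hN.ld_rinv_mem hcb
      rwa [← f.map_rinv, ← g.map_rinv] at this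
    have := hN.ld_mem_trans h hbc'
    rw [← g.map_ld] at this
    exact hdN (hN.mem_of_le this (g.mono (by decide +kernel)))
  have hd1' := hN.ld_inf_mem (hdp .p1 (by decide +kernel) (by decide +kernel))
    (hdp .p2 (by decide +kernel) (by decide +kernel))
  have he : f.toFun .e = g.toFun .e := f.map_one.trans g.map_one.symm
  rw [← f.map_inf] at hd1'
  change ld (g.toFun .d) (f.toFun .e) ∈ N at hd1'
  rw [he, ← g.map_ld] at hd1'
  exact hdN hd1'

/-! ### The algebras of the V-formation -/

theorem IsConic.isSemiconic {A : Type u} [ResiduatedLattice A] (h : IsConic A) : IsSemiconic A :=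
  fun _ _ hst => hst A h

/-- An algebra with a largest element `m` strictly below `1` is finitely subdirectly irreducible:
every nonidentity congruence relates `m` to `1`. -/
theorem isFSI_of_coatom {A : Type u} [ResiduatedLattice A] (m : A) (hm : m < 1)
    (h : ∀ x : A, x < 1 → x ≤ m) : IsFSI A := by
  have key : ∀ θ : Setoid A, IsCongruence θ → θ ≠ ⊥ → θ m 1 := by
    intro θ hθ hne
    obtain ⟨x, y, hxy, hle⟩ : ∃ x y, θ x y ∧ ¬ x ≤ y := by
      by_contra! hcon
      exact hne (le_bot_iff.1 fun {x y} hxy => le_antisymm (hcon x y hxy) (hcon y x (θ.symm hxy)))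
    have h1 := hθ.inf _ _ 1 1 (hθ.ld _ _ y y hxy (θ.refl y)) (θ.refl 1)
    rw [inf_eq_right.2 (one_le_ld_iff.2 (le_refl y))] at h1
    have h2 := hθ.sup _ _ m m h1 (θ.refl m)
    rwa [sup_eq_left.2 hm.le, sup_eq_right.2 (h _ (lt_of_le_of_ne inf_le_right fun h3 =>
      hle (one_le_ld_iff.1 (inf_eq_right.1 h3))))] at h2
  intro θ ψ hθ hψ hbot
  by_contra! hne
  have : (θ ⊓ ψ) m 1 := ⟨key θ hθ hne.1, key ψ hψ hne.2⟩
  rw [hbot] at this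
  exact hm.ne this

theorem algA_mem : CommRigidSemiconicIdempotent AlgA.{u} ∧ IsConic AlgA.{u} ∧ IsFSI AlgA.{u} := by
  have hc : IsConic AlgA.{u} := by unfold IsConic; decide +kernel
  refine ⟨⟨⟨hc.isSemiconic, ?_, ?_⟩, ?_⟩, hc, isFSI_of_coatom .a' ?_ ?_⟩
  · unfold IsIdempotent; decide +kernel
  · unfold IsRigid; decide +kernel
  · unfold IsCommutative; decide +kernel
  · rw [lt_iff_le_not_ge]; decide +kernel
  · simp only [lt_iff_le_not_ge]; decide +kernel

theorem algB_mem : CommRigidSemiconicIdempotent AlgB.{u} ∧ IsConic AlgB.{u} ∧ IsFSI AlgB.{u} := by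
  have hc : IsConic AlgB.{u} := by unfold IsConic; decide +kernel
  refine ⟨⟨⟨hc.isSemiconic, ?_, ?_⟩, ?_⟩, hc, isFSI_of_coatom .b' ?_ ?_⟩
  · unfold IsIdempotent; decide +kernel
  · unfold IsRigid; decide +kernel
  · unfold IsCommutative; decide +kernel
  · rw [lt_iff_le_not_ge]; decide +kernel
  · simp only [lt_iff_le_not_ge]; decide +kernel

theorem algC_mem : CommRigidSemiconicIdempotent AlgC.{u} ∧ IsConic AlgC.{u} ∧ IsFSI AlgC.{u} := by
  have hc : IsConic AlgC.{u} := by unfold IsConic; decide +kernel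
  refine ⟨⟨⟨hc.isSemiconic, ?_, ?_⟩, ?_⟩, hc, isFSI_of_coatom .d' ?_ ?_⟩
  · unfold IsIdempotent; decide +kernel
  · unfold IsRigid; decide +kernel
  · unfold IsCommutative; decide +kernel
  · rw [lt_iff_le_not_ge]; decide +kernel
  · simp only [lt_iff_le_not_ge]; decide +kernel

theorem inclAB_isEmbedding : inclAB.{u}.IsEmbedding := by
  rintro (_ | _ | _) (_ | _ | _) h <;> first | rfl | cases h

theorem inclAC_isEmbedding : inclAC.{u}.IsEmbedding := by
  rintro (_ | _ | _) (_ | _ | _) h <;> first | rfl | cases h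

instance : DecidableLE M3 := fun x y => inferInstanceAs (Decidable (layerLE M3.ht x y))

instance : Fintype M3 where
  elems := {.bot, .x1, .x2, .x3, .top}
  complete x := by cases x <;> simp

theorem nonempty_Icc_orderIso_M3 {P : Type u} [PartialOrder P] {x y : P} (f : M3 → P)
    (hf : ∀ i j, f i ≤ f j ↔ i ≤ j) (h : ∀ z, (∃ i, f i = z) ↔ x ≤ z ∧ z ≤ y) :
    Nonempty (Set.Icc x y ≃o M3) := by
  have hr : Set.range (OrderEmbedding.ofMapLEIff f hf) = Set.Icc x y := Set.ext h
  exact ⟨((OrderEmbedding.ofMapLEIff f hf).orderIso.trans (OrderIso.setCongr _ _ hr)).symm⟩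

theorem Icc_b_a_orderIso_M3 : Nonempty (Set.Icc (AlgB.b : AlgB.{u}) AlgB.a ≃o M3) :=
  nonempty_Icc_orderIso_M3
    (fun | .bot => .b | .x1 => .b1 | .x2 => .b2 | .x3 => .b3 | .top => .a)
    (by decide +kernel) (by decide +kernel)

theorem Icc_one_b_orderIso_M3 : Nonempty (Set.Icc (1 : AlgB.{u}) AlgB.b ≃o M3) :=
  nonempty_Icc_orderIso_M3
    (fun | .bot => 1 | .x1 => .p1 | .x2 => .p2 | .x3 => .p3 | .top => .b)
    (by decide +kernel) (by decide +kernel)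

theorem gamma_eq_a_iff : ∀ x : AlgB.{u}, gamma x = .a ↔ .b < x ∧ x ≤ .a := by
  simp only [lt_iff_le_not_ge]; decide +kernel

theorem gamma_eq_b_iff : ∀ x : AlgB.{u}, gamma x = .b ↔ 1 < x ∧ x ≤ .b := by
  simp only [lt_iff_le_not_ge]; decide +kernel

/-- The amalgamation property fails in every class of semiconic idempotent algebras that contains
the three algebras of the V-formation. -/
theorem not_amalgamationProperty (K : ∀ (D : Type u) [ResiduatedLattice D], Prop)
    (hK : ∀ (D : Type u) [ResiduatedLattice D], K D → IsSemiconic D ∧ IsIdempotent D)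
    (hA : K AlgA.{u}) (hB : K AlgB.{u}) (hC : K AlgC.{u}) : ¬ AmalgamationProperty.{u} K := by
  intro h
  obtain ⟨D, hD, f, g, hKD, -, hg, hfg⟩ :=
    h _ _ _ inclAB inclAC hA hB hC inclAB_isEmbedding inclAC_isEmbedding
  exact not_hasOneAmalgam K hK ⟨D, hD, f, g, hKD, hg, hfg⟩

end ResiduatedLattice

open ResiduatedLattice in
theorem mainTheorem12 :
    -- the amalgamation property fails for both varieties
    ¬ AmalgamationProperty.{u} RigidSemiconicIdempotent ∧
    ¬ AmalgamationProperty.{u} CommRigidSemiconicIdempotent ∧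
    -- the algebras of the witness are conic FSI members of the commutative variety
    (CommRigidSemiconicIdempotent AlgA.{u} ∧ IsConic AlgA.{u} ∧ IsFSI AlgA.{u}) ∧
    (CommRigidSemiconicIdempotent AlgB.{u} ∧ IsConic AlgB.{u} ∧ IsFSI AlgB.{u}) ∧
    (CommRigidSemiconicIdempotent AlgC.{u} ∧ IsConic AlgC.{u} ∧ IsFSI AlgC.{u}) ∧
    -- they form a V-formation
    inclAB.{u}.IsEmbedding ∧ inclAC.{u}.IsEmbedding ∧
    -- the blocks of `a` and `b` in `B` are copies of `M₃` without its bottom element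
    {x : AlgB.{u} | gamma x = AlgB.a} = Set.Ioc AlgB.b AlgB.a ∧
    {x : AlgB.{u} | gamma x = AlgB.b} = Set.Ioc 1 AlgB.b ∧
    Nonempty (Set.Icc (AlgB.b : AlgB.{u}) AlgB.a ≃o M3) ∧
    Nonempty (Set.Icc (1 : AlgB.{u}) AlgB.b ≃o M3) ∧
    -- there is no 1-amalgam
    ¬ HasOneAmalgam.{u} RigidSemiconicIdempotent inclAB.{u} inclAC.{u} :=
  ⟨not_amalgamationProperty _ (fun _ _ h => ⟨h.1, h.2.1⟩) algA_mem.1.1 algB_mem.1.1 algC_mem.1.1,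
    not_amalgamationProperty _ (fun _ _ h => ⟨h.1.1, h.1.2.1⟩) algA_mem.1 algB_mem.1 algC_mem.1,
    algA_mem, algB_mem, algC_mem, inclAB_isEmbedding, inclAC_isEmbedding,
    Set.ext gamma_eq_a_iff, Set.ext gamma_eq_b_iff, Icc_b_a_orderIso_M3, Icc_one_b_orderIso_M3,
    not_hasOneAmalgam _ fun _ _ h => ⟨h.1, h.2.1⟩⟩
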